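/- **Setting.** Consider the network of $5$ elastoplastic springs on $4$ nodes with stiffnesses $a_1,\dots,a_5>0$, $A=\mathrm{diag}(a_1,\dots,a_5)$, and elastic limits $c_j^-\le c_j^+$, $j=1,\dots,5$, whose kinematic matrix and loading vector are $$D=\begin{pmatrix}-1&1&0&0\\-1&0&1&0\\0&-1&1&0\\0&-1&0&1\\0&0&-1&1\end{pmatrix},\qquad R=(1,0,1,0,1)^T,$$ with displacement-controlled loading $l(t)=l_0+l_1t$, $l_0,l_1>0$. Put $$\mathcal V_{basis}=\begin{pmatrix}0&1/a_1&1/a_1\\0&1/a_2&-1/a_2\\1/a_3&0&1/a_3\\-1/a_4&1/a_4&0\\1/a_5&1/a_5&0\end{pmatrix},\quad D^\perp=\begin{pmatrix}0&1\\0&-1\\1&1\\-1&0\\1&0\end{pmatrix},\quad W=\begin{pmatrix}R^T\\(D^\perp)^T\end{pmatrix}\mathcal V_{basis},\quad \bar L=W^{-1}\begin{pmatrix}1\\0\\0\end{pmatrix},$$ $\mathcal V=\mathcal V_{basis}\mathbb R^3$, $c(t)=-\mathcal V_{basis}\bar L\,l(t)$, $C=\{y\in\mathcal V: c_j^-\le\langle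 e_j,Ay\rangle\le c_j^+,\ j=1,\dots,5\}$ and $C(t)=C+c(t)$. For $y\in C(t)$ let $N^A_{C(t)}(y)=\{x\in\mathcal V:\langle x,A(\xi-y)\rangle\le 0\ \text{for all }\xi\in C(t)\}$, and $N^A_{C(t)}(y)=\emptyset$ for $y\notin C(t)$. The evolution of the network is given by the (locally absolutely continuous) solutions $y:[0,\infty)\to\mathbb R^5$ of the sweeping process $-\dot y(t)\in N^A_{C(t)}(y(t))$ for a.e. $t\ge0$, $y(0)\in C(0)$. The stress vector $s(t)$ is given by $y(t)=A^{-1}s(t)+c(t)$. Spring $j$ is said to undergo plastic deformation at time $t$ if the inequality $c_j^-<s_j(t)<c_j^+$ is violated. Write $\|x\|^A=\sqrt{\langle x,Ax\rangle}$ and $c^\pm=(c_1^\pm,\dots,c_5^\pm)^T$. **Scenarios.** Each of the scenarios $1$–$6$ consists of a pair $I_0$ of springs, a spring $k\notin I_0$, and a vector $v(x)\in\mathbb R^5$ depending on $x\in\mathbb R$ (the value of the stress of spring $k$): 1. $I_0=\{1,2\}$, $k=3$, $v(x)=(c_1^+,\ c_2^+,\ x,\ c_1^+-x,\ c_2^++x)$;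 2. $I_0=\{1,2\}$, $k=4$, $v(x)=(c_1^+,\ c_2^+,\ c_1^+-x,\ x,\ c_1^++c_2^+-x)$; 3. $I_0=\{1,2\}$, $k=5$, $v(x)=(c_1^+,\ c_2^+,\ -c_2^++x,\ c_1^++c_2^+-x,\ x)$; 4. $I_0=\{4,5\}$, $k=1$, $v(x)=(x,\ -x+c_4^++c_5^+,\ x-c_4^+,\ c_4^+,\ c_5^+)$; 5. $I_0=\{4,5\}$, $k=2$, $v(x)=(-x+c_4^++c_5^+,\ x,\ -x+c_5^+,\ c_4^+,\ c_5^+)$; 6. $I_0=\{4,5\}$, $k=3$, $v(x)=(x+c_4^+,\ -x+c_5^+,\ x,\ c_4^+,\ c_5^+)$. The feasibility condition of a scenario is that $c_j^-\le v_j(c_k^-)\le c_j^+$ and $c_j^-\le v_j(c_k^+)\le c_j^+$ for the two springs $j\notin I_0\cup\{k\}$. **Constants.** Let $P=a_4a_5+a_3(a_4+a_5)$, $Q=a_1a_2+a_3(a_1+a_2)$ and $\Delta=a_3a_4+a_2(a_3+a_4)+a_3a_5+a_4a_5+a_1(a_2+a_3+a_5)$. In scenarios 1–3 $$\varepsilon_0=\min\left\{l_1\sqrt{\frac{a_2P}{a_2(a_3+a_4)+P}},\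 l_1\sqrt{\frac{a_1P}{a_1(a_3+a_5)+P}}\right\},$$ and in scenarios 4–6 $$\varepsilon_0=\min\left\{l_1\sqrt{\frac{a_5Q}{a_5(a_3+a_1)+Q}},\ l_1\sqrt{\frac{a_4Q}{a_4(a_3+a_2)+Q}}\right\}.$$ Moreover $\sigma_1=\sigma_2=\max\{1,\rho\}$, where $\rho$ is, in scenarios $1,\dots,6$ respectively, $$\frac{(a_1+a_4)(a_2+a_5)P}{a_4a_5\Delta},\quad \frac{(a_3(a_2+a_5)+a_1(a_2+a_3+a_5))P}{a_3a_5\Delta},\quad \frac{(a_1(a_2+a_3)+a_3a_4+a_2(a_3+a_4))P}{a_3a_4\Delta},$$ $$\frac{Q\,(a_2(a_3+a_4)+P)}{a_2a_3\Delta},\quad \frac{Q\,(a_1(a_3+a_5)+P)}{a_1a_3\Delta},\quad \frac{Q\,(a_1+a_4)(a_2+a_5)}{a_1a_2\Delta}.$$ **Proposition.** Assume that the feasibility condition of one of the scenarios $1$–$6$ holds, and put $$\tau_d=\frac{\max\{\sqrt{\sigma_1},\sqrt{\sigma_2}\}}{\varepsilon_0}\,\|A^{-1}c^+-A^{-1}c^-\|^A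 .$$ Then, for any initial values of stresses (that is, for every solution $y$ with $y(0)\in C(0)$), the two springs of $I_0$ undergo plastic deformation at all $t\ge\tau_d$, with $s_j(t)=c_j^+$ for $j\in I_0$, and the stress vector $s(t)$ is constant on $[\tau_d,\infty)$ and equal to a point of the line segment with the endpoints $v(c_k^-)$ and $v(c_k^+)$. Conversely, every point of this segment is the constant value of $s(t)$, $t\ge\tau_d$, for some solution. -/

import Mathlib

open MeasureTheory Set Matrix

/-! ### Sweeping processes in a subspace of `ℝ^m` with a weighted scalar product -/

/-- The norm `‖x‖^A = √⟨x, A x⟩`. -/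
noncomputable def weightedNorm {m : ℕ} (A : Matrix (Fin m) (Fin m) ℝ) (x : Fin m → ℝ) : ℝ :=
  Real.sqrt (x ⬝ᵥ (A *ᵥ x))

/-- The normal cone `N_C^A(y)` to `C` at `y` in the space `V` with the scalar product
`⟨x, A y⟩`; it is empty when `y ∉ C`. -/
def normalCone {m : ℕ} (A : Matrix (Fin m) (Fin m) ℝ) (V : Submodule ℝ (Fin m → ℝ))
    (C : Set (Fin m → ℝ)) (y : Fin m → ℝ) : Set (Fin m → ℝ) :=
  {x | x ∈ V ∧ y ∈ C ∧ ∀ ξ ∈ C, x ⬝ᵥ (A *ᵥ (ξ - y)) ≤ 0}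

/-- The polyhedron `C = ⋂ⱼ {y ∈ V : cⱼ⁻ ≤ ⟨eⱼ, A y⟩ ≤ cⱼ⁺}`. -/
def elasticSet {m : ℕ} (A : Matrix (Fin m) (Fin m) ℝ) (V : Submodule ℝ (Fin m → ℝ))
    (cm cp : Fin m → ℝ) : Set (Fin m → ℝ) :=
  {y | y ∈ V ∧ ∀ j, cm j ≤ (A *ᵥ y) j ∧ (A *ᵥ y) j ≤ cp j}

/-- The moving set `C(t) = C + c(t)`. -/
def movingSet {m : ℕ} (C : Set (Fin m → ℝ)) (c : ℝ → Fin m → ℝ) (t : ℝ) : Set (Fin m → ℝ) :=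
  (fun x => x + c t) '' C

/-- `y` is a (locally absolutely continuous) solution on `[0, ∞)` of the sweeping process
`-y'(t) ∈ N_{C(t)}^A(y(t))`, `C(t) = C + c(t)`, with an admissible initial value
`y(0) ∈ C(0)`. -/
structure IsSweepingSolution {m : ℕ} (A : Matrix (Fin m) (Fin m) ℝ)
    (V : Submodule ℝ (Fin m → ℝ)) (C : Set (Fin m → ℝ)) (c : ℝ → Fin m → ℝ)
    (y : ℝ → Fin m → ℝ) : Prop where
  absCont : ∀ T : ℝ, 0 < T → AbsolutelyContinuousOnInterval y 0 T
  init : y 0 ∈ movingSet C c 0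
  inclusion : ∀ᵐ t ∂(volume.restrict (Ici (0 : ℝ))),
    ∃ y' : Fin m → ℝ, HasDerivAt y y' t ∧ -y' ∈ normalCone A V (movingSet C c t) (y t)

/-- A spring deforms plastically when the strict inequality `cⱼ⁻ < sⱼ < cⱼ⁺` for its stress
is violated. -/
def IsPlastic {m : ℕ} (cm cp s : Fin m → ℝ) (j : Fin m) : Prop :=
  ¬ (cm j < s j ∧ s j < cp j)

namespace FiveSprings

/-! ### The network of 5 springs on 4 nodes
Springs `1, …, 5` are indexed by `0, …, 4 : Fin 5`. -/

/-- Kinematic matrix of the network. -/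
def D : Matrix (Fin 5) (Fin 4) ℝ :=
  !![-1, 1, 0, 0;
     -1, 0, 1, 0;
     0, -1, 1, 0;
     0, -1, 0, 1;
     0, 0, -1, 1]

/-- Location of the displacement-controlled loading (along the path of springs 1, 3, 5). -/
def R : Fin 5 → ℝ := ![1, 0, 1, 0, 1]

/-- A matrix with `Rᵀ D M = 0` such that `D M` has full rank. -/
def M : Matrix (Fin 4) (Fin 2) ℝ := !![0, 0; 1, 1; 1, -1; 0, 0]

/-- The diagonal matrix of stiffnesses. -/
def stiffness (a : Fin 5 → ℝ) : Matrix (Fin 5) (Fin 5) ℝ := Matrix.diagonal a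

/-- Three independent columns with `(D M)ᵀ A 𝒱_basis = 0`. -/
noncomputable def Vbasis (a : Fin 5 → ℝ) : Matrix (Fin 5) (Fin 3) ℝ :=
  !![0, 1 / a 0, 1 / a 0;
     0, 1 / a 1, -1 / a 1;
     1 / a 2, 0, 1 / a 2;
     -1 / a 3, 1 / a 3, 0;
     1 / a 4, 1 / a 4, 0]

/-- A full rank matrix with `(D^⊥)ᵀ D = 0`. -/
def Dperp : Matrix (Fin 5) (Fin 2) ℝ := !![0, 1; 0, -1; 1, 1; -1, 0; 1, 0]

/-- The `3 × 5` matrix with the rows `Rᵀ` and `(D^⊥)ᵀ`. -/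
def RD : Matrix (Fin 3) (Fin 5) ℝ := Matrix.of (Matrix.vecCons R Dperpᵀ)

/-- `W` is the product of that matrix with `𝒱_basis`. -/
noncomputable def W (a : Fin 5 → ℝ) : Matrix (Fin 3) (Fin 3) ℝ := RD * Vbasis a

/-- `L̄ = W⁻¹ (1, 0, 0)ᵀ`. -/
noncomputable def Lbar (a : Fin 5 → ℝ) : Fin 3 → ℝ := (W a)⁻¹ *ᵥ ![1, 0, 0]

/-- The phase space `𝒱 = 𝒱_basis ℝ³` of the sweeping process. -/
noncomputable def phaseSpace (a : Fin 5 → ℝ) : Submodule ℝ (Fin 5 → ℝ) :=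
  LinearMap.range (Vbasis a).mulVecLin

/-- The loading `l(t) = l₀ + l₁ t`. -/
def loading (l₀ l₁ t : ℝ) : ℝ := l₀ + l₁ * t

/-- `c(t) = -𝒱_basis L̄ l(t)`. -/
noncomputable def shift (a : Fin 5 → ℝ) (l₀ l₁ t : ℝ) : Fin 5 → ℝ :=
  -(loading l₀ l₁ t • (Vbasis a *ᵥ Lbar a))

/-- The matrices above satisfy the relations that define them. -/
theorem Dperp_mul_D : Dperpᵀ * D = 0 := by
  ext i j
  fin_cases i <;> fin_cases j <;>
    simp [Dperp, D, Matrix.mul_apply, Fin.sum_univ_five]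

theorem DM_eq : D * M = !![1, 1; 1, -1; 0, -2; -1, -1; -1, 1] := by
  ext i j
  fin_cases i <;> fin_cases j <;>
    simp [D, M, Matrix.mul_apply, Fin.sum_univ_four]
  norm_num

theorem R_mul_D_mul_M (i : Fin 2) : ∑ j, R j * (D * M) j i = 0 := by
  fin_cases i <;>
    simp [R, DM_eq, Fin.sum_univ_five]
  norm_num

theorem DM_orthogonal_Vbasis (a : Fin 5 → ℝ) (ha : ∀ j, 0 < a j) :
    (D * M)ᵀ * (stiffness a * Vbasis a) = 0 := by
  have h := fun j => (ha j).ne'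
  have e : stiffness a * Vbasis a = !![0, 1, 1; 0, 1, -1; 1, 0, 1; -1, 1, 0; 1, 1, 0] := by
    ext i j
    fin_cases i <;> fin_cases j <;>
      simp [stiffness, Vbasis, Matrix.diagonal_mul, h, mul_div_assoc']
  rw [e, DM_eq]
  ext i j
  fin_cases i <;> fin_cases j <;> simp [Matrix.mul_apply, Fin.sum_univ_five] <;> norm_num

/-- The common factor `Δ` of the denominators in the formulas for `σ₁ = σ₂`. -/
def Δ (a : Fin 5 → ℝ) : ℝ :=
  a 2 * a 3 + a 1 * (a 2 + a 3) + a 2 * a 4 + a 3 * a 4 + a 0 * (a 1 + a 2 + a 4)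

/-- The matrix `W` is invertible, so its inverse in `L̄` is the genuine one. -/
theorem isUnit_det_W (a : Fin 5 → ℝ) (ha : ∀ j, 0 < a j) : IsUnit (W a).det := by
  have h0 := ha 0
  have h1 := ha 1
  have h2 := ha 2
  have h3 := ha 3
  have h4 := ha 4
  have hRD : RD = !![1, 0, 1, 0, 1; 0, 0, 1, -1, 1; 1, -1, 1, 0, 0] := by
    ext i j
    fin_cases i <;> fin_cases j <;> rfl
  have e : (W a).det = -(2 * (Δ a / (a 0 * a 1 * a 2 * a 3 * a 4))) := by
    simp only [W, hRD, Vbasis, Matrix.det_fin_three, Matrix.mul_apply, Fin.sum_univ_five]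
    simp
    unfold Δ
    field_simp
    ring
  have h5 : 0 < Δ a := by unfold Δ; positivity
  rw [e, isUnit_iff_ne_zero, neg_ne_zero]
  positivity

/-- `y` solves the sweeping process of the network, with an admissible initial value. -/
def IsSolution (a cm cp : Fin 5 → ℝ) (l₀ l₁ : ℝ) (y : ℝ → Fin 5 → ℝ) : Prop :=
  IsSweepingSolution (stiffness a) (phaseSpace a)
    (elasticSet (stiffness a) (phaseSpace a) cm cp) (shift a l₀ l₁) y

/-- The vector of stresses `s(t)`, given by `y(t) = A⁻¹ s(t) + c(t)`. -/
noncomputable def stress (a : Fin 5 → ℝ) (l₀ l₁ : ℝ) (y : ℝ → Fin 5 → ℝ) (t : ℝ) : Fin 5 → ℝ :=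
  stiffness a *ᵥ (y t - shift a l₀ l₁ t)

/-! ### The six scenarios -/

inductive Scenario : Type
  | s1 | s2 | s3 | s4 | s5 | s6

/-- The springs of `I₀`; the sign of every index of `I₀` is `+`. -/
def Scenario.I₀ : Scenario → Finset (Fin 5)
  | .s1 => {0, 1}
  | .s2 => {0, 1}
  | .s3 => {0, 1}
  | .s4 => {3, 4}
  | .s5 => {3, 4}
  | .s6 => {3, 4}

/-- The spring `k` of `I₁ = {(-, k)}` and `I₂ = {(+, k)}`. -/
def Scenario.free : Scenario → Fin 5
  | .s1 => 2
  | .s2 => 3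
  | .s3 => 4
  | .s4 => 0
  | .s5 => 1
  | .s6 => 2

/-- The stresses in the network when the springs of `I₀` have their upper limit stresses and the
spring `k` of `I₁`, `I₂` has the stress `x`. -/
def Scenario.terminalStress (cp : Fin 5 → ℝ) (x : ℝ) : Scenario → Fin 5 → ℝ
  | .s1 => ![cp 0, cp 1, x, cp 0 - x, cp 1 + x]
  | .s2 => ![cp 0, cp 1, cp 0 - x, x, cp 0 + cp 1 - x]
  | .s3 => ![cp 0, cp 1, -cp 1 + x, cp 0 + cp 1 - x, x]
  | .s4 => ![x, -x + cp 3 + cp 4, x - cp 3, cp 3, cp 4]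
  | .s5 => ![-x + cp 3 + cp 4, x, -x + cp 4, cp 3, cp 4]
  | .s6 => ![x + cp 3, -x + cp 4, x, cp 3, cp 4]

/-- The endpoint `A y_{*,1}` of the segment of terminal stresses. -/
def Scenario.vertex₁ (sc : Scenario) (cm cp : Fin 5 → ℝ) : Fin 5 → ℝ :=
  sc.terminalStress cp (cm sc.free)

/-- The endpoint `A y_{*,2}` of the segment of terminal stresses. -/
def Scenario.vertex₂ (sc : Scenario) (cp : Fin 5 → ℝ) : Fin 5 → ℝ :=
  sc.terminalStress cp (cp sc.free)

/-- Feasibility condition: at both endpoints, the stresses of the two springs outside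
`I₀ ∪ I₁ ∪ I₂` are within their limits. -/
def Scenario.Feasible (sc : Scenario) (cm cp : Fin 5 → ℝ) : Prop :=
  ∀ j : Fin 5, j ∉ sc.I₀ → j ≠ sc.free →
    (cm j ≤ sc.vertex₁ cm cp j ∧ sc.vertex₁ cm cp j ≤ cp j) ∧
    (cm j ≤ sc.vertex₂ cp j ∧ sc.vertex₂ cp j ≤ cp j)

/-- The function `h(x, y)` of scenarios 1, 2, 3. -/
noncomputable def hUpper (a : Fin 5 → ℝ) (l₁ x y : ℝ) : ℝ :=
  l₁ * Real.sqrt (x * (a 3 * a 4 + a 2 * (a 3 + a 4)) /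
    (x * (a 2 + y) + a 3 * a 4 + a 2 * (a 3 + a 4)))

/-- The function `h(x, y)` of scenarios 4, 5, 6. -/
noncomputable def hLower (a : Fin 5 → ℝ) (l₁ x y : ℝ) : ℝ :=
  l₁ * Real.sqrt (x * (a 0 * a 1 + a 2 * (a 0 + a 1)) /
    (x * (a 2 + y) + a 0 * a 1 + a 2 * (a 0 + a 1)))

/-- The constant `ε₀`. -/
noncomputable def Scenario.ε₀ (a : Fin 5 → ℝ) (l₁ : ℝ) : Scenario → ℝ
  | .s1 => min (hUpper a l₁ (a 1) (a 3)) (hUpper a l₁ (a 0) (a 4))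
  | .s2 => min (hUpper a l₁ (a 1) (a 3)) (hUpper a l₁ (a 0) (a 4))
  | .s3 => min (hUpper a l₁ (a 1) (a 3)) (hUpper a l₁ (a 0) (a 4))
  | .s4 => min (hLower a l₁ (a 4) (a 0)) (hLower a l₁ (a 3) (a 1))
  | .s5 => min (hLower a l₁ (a 4) (a 0)) (hLower a l₁ (a 3) (a 1))
  | .s6 => min (hLower a l₁ (a 4) (a 0)) (hLower a l₁ (a 3) (a 1))

/-- The constant `σ₁`. -/
noncomputable def Scenario.σ₁ (a : Fin 5 → ℝ) : Scenario → ℝ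
  | .s1 => max 1 ((a 0 + a 3) * (a 1 + a 4) * (a 3 * a 4 + a 2 * (a 3 + a 4)) /
      (a 3 * a 4 * Δ a))
  | .s2 => max 1 ((a 2 * (a 1 + a 4) + a 0 * (a 1 + a 2 + a 4)) *
      (a 3 * a 4 + a 2 * (a 3 + a 4)) / (a 2 * a 4 * Δ a))
  | .s3 => max 1 ((a 0 * (a 1 + a 2) + a 2 * a 3 + a 1 * (a 2 + a 3)) *
      (a 3 * a 4 + a 2 * (a 3 + a 4)) / (a 2 * a 3 * Δ a))
  | .s4 => max 1 ((a 1 * a 2 + a 0 * (a 1 + a 2)) *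
      (a 1 * (a 2 + a 3) + a 3 * a 4 + a 2 * (a 3 + a 4)) / (a 1 * a 2 * Δ a))
  | .s5 => max 1 ((a 1 * a 2 + a 0 * (a 1 + a 2)) *
      (a 3 * a 4 + a 0 * (a 2 + a 4) + a 2 * (a 3 + a 4)) / (a 0 * a 2 * Δ a))
  | .s6 => max 1 ((a 1 * a 2 + a 0 * (a 1 + a 2)) * (a 0 + a 3) * (a 1 + a 4) /
      (a 0 * a 1 * Δ a))

/-- The constant `σ₂ = σ₁`. -/
noncomputable def Scenario.σ₂ (a : Fin 5 → ℝ) (sc : Scenario) : ℝ := sc.σ₁ a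

/-- `τ_d = max{√σ₁, √σ₂} ε₀⁻¹ ‖A⁻¹ c⁺ - A⁻¹ c⁻‖^A`. -/
noncomputable def Scenario.τd (sc : Scenario) (a cm cp : Fin 5 → ℝ) (l₁ : ℝ) : ℝ :=
  max (Real.sqrt (sc.σ₁ a)) (Real.sqrt (sc.σ₂ a)) / sc.ε₀ a l₁ *
    weightedNorm (stiffness a) ((stiffness a)⁻¹ *ᵥ cp - (stiffness a)⁻¹ *ᵥ cm)

end FiveSprings

/-! In stress variables the moving set stands still. The admissible stresses are the balanced
vectors within the elastic limits, and the loading acts on them only through the force `F s = s 0 +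
s 1`. With the energy norm, the normal cone inclusion becomes `⟨s', p - s⟩ ≥ l₁ * (F p - F s)` for
every admissible `p` (`exists_hasDerivAt_energyCoord_stress`).

On the terminal segment `K` the force attains its maximum, because by balance `F s = s 3 + s 4` as
well, and both springs of `I₀` sit at their upper limits. The maximum is sharp: the missing force
bounds the distance to `K` linearly, `l₁ * (F p - F s) ≥ κ * dist(s, K)` for `p` in `K`, with `κ =
ε₀ / √σ₁` (`Scenario.ε₀_mul_dist_le`). This is a finite-dimensional estimate: moving to the point of
`K` with the same stress in the free spring changes the stresses by a linear function of the two
nonnegative deficits in `I₀`.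

Hence the distance to `K` decreases at rate at least `κ` while it is positive, and it vanishes by
`τ_d` since it is at most `‖A⁻¹c⁺ - A⁻¹c⁻‖^A` at the start. The distance to each single point of `K`
is also nonincreasing, so a trajectory that has reached `K` stays where it arrived
(`finite_time_absorption`). Conversely, a maximizer of `F` is an equilibrium for the stresses
(`isSolution_of_forall_le`). -/

theorem AbsolutelyContinuousOnInterval.lipschitz_comp {X Y : Type*} [PseudoMetricSpace X]
    [PseudoMetricSpace Y] {φ : X → Y} {K : NNReal} (hφ : LipschitzWith K φ) {f : ℝ → X} {a b : ℝ}
    (hf : AbsolutelyContinuousOnInterval f a b) :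
    AbsolutelyContinuousOnInterval (fun t => φ (f t)) a b := by
  have h : Filter.Tendsto (fun E : ℕ × (ℕ → ℝ × ℝ) =>
      (K : ℝ) * ∑ i ∈ Finset.range E.1, dist (f (E.2 i).1) (f (E.2 i).2)) _ _ :=
    Filter.Tendsto.const_mul (K : ℝ) hf
  rw [mul_zero] at h
  refine squeeze_zero (fun E => Finset.sum_nonneg fun i _ => dist_nonneg) (fun E => ?_) h
  rw [Finset.mul_sum]
  exact Finset.sum_le_sum fun i _ => hφ.dist_le_mul _ _

theorem AbsolutelyContinuousOnInterval.sub_le_mul_of_deriv_le {f : ℝ → ℝ} {a b C : ℝ}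
    (hab : a ≤ b) (hf : AbsolutelyContinuousOnInterval f a b)
    (h : ∀ᵐ t, t ∈ Icc a b → DifferentiableAt ℝ f t → deriv f t ≤ C) :
    f b - f a ≤ C * (b - a) := by
  rw [← hf.integral_deriv_eq_sub]
  have hint := intervalIntegral.integral_mono_ae_restrict hab hf.intervalIntegrable_deriv
    (intervalIntegrable_const (c := C)) ?_
  · simpa [mul_comm] using hint
  · rw [Filter.EventuallyLE, ae_restrict_iff' measurableSet_Icc]
    filter_upwards [h, hf.ae_differentiableAt] with t h₁ h₂ ht
    exact h₁ ht (h₂ (by rwa [uIcc_of_le hab]))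

/-! ### Finite-time absorption by a compact set -/

section Absorption

variable {E : Type*} [NormedAddCommGroup E] [InnerProductSpace ℝ E]

/-- An envelope argument that needs no convexity. For `p` nearest to `z t`, the function `‖z s - p‖²
- infDist²` is nonnegative and vanishes at `s = t`, so the two squares have the same derivative
there. -/
theorem infDist_mul_deriv_infDist_le {K : Set E} (hK : IsCompact K) (hne : K.Nonempty)
    {z : ℝ → E} {z' : E} {t r : ℝ} (hz : HasDerivAt z z' t)
    (hr : ∀ p ∈ K, r ≤ inner ℝ z' (p - z t))
    (hd : DifferentiableAt ℝ (fun s => Metric.infDist (z s) K) t) :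
    Metric.infDist (z t) K * deriv (fun s => Metric.infDist (z s) K) t ≤ -r := by
  obtain ⟨p, hp, hdist⟩ := hK.exists_infDist_eq_dist hne (z t)
  have hmin : IsLocalMin (fun s => ‖z s - p‖ ^ 2 - Metric.infDist (z s) K ^ 2) t := by
    refine Filter.Eventually.of_forall fun s => ?_
    have h₁ : Metric.infDist (z s) K ≤ ‖z s - p‖ := by
      rw [← dist_eq_norm]
      exact Metric.infDist_le_dist_of_mem hp
    have h₂ : Metric.infDist (z s) K ^ 2 ≤ ‖z s - p‖ ^ 2 :=
      pow_le_pow_left₀ Metric.infDist_nonneg h₁ 2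
    simp only [hdist, ← dist_eq_norm, sub_self]
    rw [← dist_eq_norm] at h₂
    linarith
  have hder := ((hz.sub_const p).norm_sq).sub (hd.hasDerivAt.pow 2)
  have h0 := hmin.hasDerivAt_eq_zero hder
  have hrp := hr p hp
  have hneg : inner ℝ z' (p - z t) = -inner ℝ (z t - p) z' := by
    rw [← neg_sub (z t) p, inner_neg_right, real_inner_comm]
  simp at h0
  linarith

theorem finite_time_absorption {K : Set E} (hK : IsCompact K) (hne : K.Nonempty)
    {z : ℝ → E} (hz : ∀ T : ℝ, 0 < T → AbsolutelyContinuousOnInterval z 0 T) {κ τ : ℝ}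
    (hκ : 0 < κ)
    (h : ∀ᵐ t ∂(volume.restrict (Ici (0 : ℝ))), ∃ z', HasDerivAt z z' t ∧
      ∀ p ∈ K, κ * Metric.infDist (z t) K ≤ inner ℝ z' (p - z t))
    (hτ : Metric.infDist (z 0) K ≤ κ * τ) :
    ∃ p ∈ K, ∀ t, τ ≤ t → z t = p := by
  rw [ae_restrict_iff' measurableSet_Ici] at h
  have hτ0 : 0 ≤ τ := nonneg_of_mul_nonneg_right (Metric.infDist_nonneg.trans hτ) hκ
  have hac : ∀ L : Set E, ∀ s t : ℝ, 0 ≤ s → s ≤ t →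
      AbsolutelyContinuousOnInterval (fun r => Metric.infDist (z r) L) s t := by
    intro L s t hs hst
    -- The interval is enlarged to `t + 1` because `t` may be `0`.
    refine ((hz (t + 1) (by linarith)).mono ?_).lipschitz_comp (Metric.lipschitz_infDist_pt L)
    rw [uIcc_of_le hst, uIcc_of_le (by linarith)]
    exact Icc_subset_Icc hs (by linarith)
  -- Needed for `L = K`, to keep the distance positive before `τ`, and for a singleton, to freeze
  -- the trajectory after `τ`.
  have hanti : ∀ L ⊆ K, IsCompact L → L.Nonempty → ∀ s t : ℝ, 0 ≤ s → s ≤ t →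
      Metric.infDist (z t) L ≤ Metric.infDist (z s) L := by
    intro L hLK hL hLne s t hs hst
    -- The squared distance is used because only the product of the distance and its derivative is
    -- controlled, which gives nothing about the derivative where the distance vanishes.
    have hsq := (hac L s t hs hst).mul (hac L s t hs hst)
    have hle := hsq.sub_le_mul_of_deriv_le (C := 0) hst ?_
    · simp only [Pi.mul_apply, zero_mul] at hle
      nlinarith [Metric.infDist_nonneg (x := z s) (s := L),
        Metric.infDist_nonneg (x := z t) (s := L)]
    · filter_upwards [h, (hac L s t hs hst).ae_differentiableAt] with r hr hdr hrm _
      obtain ⟨z', hz', hin⟩ := hr (hs.trans hrm.1)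
      have hd := hdr (by rwa [uIcc_of_le hst])
      have hb := infDist_mul_deriv_infDist_le hL hLne hz' (r := 0)
        (fun p hp => (mul_nonneg hκ.le Metric.infDist_nonneg).trans (hin p (hLK hp))) hd
      rw [(hd.hasDerivAt.mul hd.hasDerivAt).deriv]
      linarith
  have hzero : Metric.infDist (z τ) K = 0 := by
    by_contra hpos
    have hpos : 0 < Metric.infDist (z τ) K := lt_of_le_of_ne Metric.infDist_nonneg (Ne.symm hpos)
    -- A positive distance at `τ` would be positive on all of `[0, τ]`, so its derivative would be
    -- at most `-κ` almost everywhere and the distance at `τ` at most `infDist (z 0) K - κ * τ ≤ 0`.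
    have hle := (hac K 0 τ le_rfl hτ0).sub_le_mul_of_deriv_le (C := -κ) hτ0 ?_
    · linarith
    · filter_upwards [h] with r hr hrm hd
      obtain ⟨z', hz', hin⟩ := hr hrm.1
      have hb := infDist_mul_deriv_infDist_le hK hne hz' hin hd
      have hrpos := hpos.trans_le (hanti K subset_rfl hK hne r τ hrm.1 hrm.2)
      by_contra! hlt
      nlinarith
  have hmem : z τ ∈ K := (hK.isClosed.mem_iff_infDist_zero hne).2 hzero
  refine ⟨z τ, hmem, fun t ht => ?_⟩
  have hle := hanti {z τ} (singleton_subset_iff.2 hmem) isCompact_singleton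
    (singleton_nonempty _) τ t hτ0 ht
  rw [Metric.infDist_singleton, Metric.infDist_singleton, dist_self] at hle
  exact dist_le_zero.1 hle

end Absorption

namespace FiveSprings

/-! ### Stresses in equilibrium -/

/-- The equilibrium conditions that single out the stress vectors `A 𝒱`. -/
def Balanced (s : Fin 5 → ℝ) : Prop := s 0 + s 1 = s 3 + s 4 ∧ s 0 = s 2 + s 3

/-- Stress vectors in equilibrium within the elastic limits. -/
def stressSet (cm cp : Fin 5 → ℝ) : Set (Fin 5 → ℝ) :=
  {s | Balanced s ∧ ∀ j, cm j ≤ s j ∧ s j ≤ cp j}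

theorem convex_stressSet (cm cp : Fin 5 → ℝ) : Convex ℝ (stressSet cm cp) := by
  rintro s ⟨⟨hs₁, hs₂⟩, hs⟩ r ⟨⟨hr₁, hr₂⟩, hr⟩ u v hu hv huv
  refine ⟨⟨?_, ?_⟩, fun j => ?_⟩
  · simp only [Pi.add_apply, Pi.smul_apply, smul_eq_mul]
    linear_combination u * hs₁ + v * hr₁
  · simp only [Pi.add_apply, Pi.smul_apply, smul_eq_mul]
    linear_combination u * hs₂ + v * hr₂
  · exact convex_Icc (cm j) (cp j) (hs j) (hr j) hu hv huv

theorem stiffness_mulVec (a u : Fin 5 → ℝ) (j : Fin 5) : (stiffness a *ᵥ u) j = a j * u j := by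
  simp [stiffness, Matrix.mulVec_diagonal]

theorem stiffness_mulVec_div {a : Fin 5 → ℝ} (ha : ∀ j, 0 < a j) (s : Fin 5 → ℝ) :
    stiffness a *ᵥ (fun j => s j / a j) = s := by
  ext j
  rw [stiffness_mulVec, mul_div_cancel₀ _ (ha j).ne']

theorem stiffness_mulVec_Vbasis {a : Fin 5 → ℝ} (ha : ∀ j, 0 < a j) (v : Fin 3 → ℝ) :
    stiffness a *ᵥ (Vbasis a *ᵥ v) =
      ![v 1 + v 2, v 1 - v 2, v 0 + v 2, v 1 - v 0, v 0 + v 1] := by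
  have h := fun j => (ha j).ne'
  ext j
  rw [stiffness_mulVec]
  fin_cases j <;>
    simp [Vbasis, Matrix.mulVec, dotProduct, Fin.sum_univ_three] <;> field_simp [h] <;> ring

theorem mem_phaseSpace_iff {a : Fin 5 → ℝ} (ha : ∀ j, 0 < a j) (u : Fin 5 → ℝ) :
    u ∈ phaseSpace a ↔ Balanced (stiffness a *ᵥ u) := by
  constructor
  · rintro ⟨v, rfl⟩
    rw [Matrix.mulVecLin_apply, stiffness_mulVec_Vbasis ha]
    constructor
    · simp; ring
    · simp; ring
  · rintro ⟨h₁, h₂⟩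
    obtain ⟨s, hs⟩ : ∃ s, stiffness a *ᵥ u = s := ⟨_, rfl⟩
    rw [hs] at h₁ h₂
    -- The coefficients solve the equations of the first three springs; balance gives the other two.
    refine ⟨![s 2 - (s 0 - s 1) / 2, (s 0 + s 1) / 2, (s 0 - s 1) / 2], ?_⟩
    have e : stiffness a *ᵥ (Vbasis a *ᵥ
        ![s 2 - (s 0 - s 1) / 2, (s 0 + s 1) / 2, (s 0 - s 1) / 2]) = s := by
      rw [stiffness_mulVec_Vbasis ha]
      ext j
      fin_cases j <;> simp <;> linarith
    rw [Matrix.mulVecLin_apply]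
    ext j
    have ej := congrFun (e.trans hs.symm) j
    rw [stiffness_mulVec, stiffness_mulVec] at ej
    exact mul_left_cancel₀ (ha j).ne' ej

theorem mem_elasticSet_iff {a cm cp : Fin 5 → ℝ} (ha : ∀ j, 0 < a j) (u : Fin 5 → ℝ) :
    u ∈ elasticSet (stiffness a) (phaseSpace a) cm cp ↔
      stiffness a *ᵥ u ∈ stressSet cm cp := by
  rw [elasticSet, stressSet, mem_ofPred_eq, mem_ofPred_eq, mem_phaseSpace_iff ha]

theorem RD_mulVec_Vbasis_Lbar {a : Fin 5 → ℝ} (ha : ∀ j, 0 < a j) :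
    RD *ᵥ (Vbasis a *ᵥ Lbar a) = ![1, 0, 0] := by
  rw [Matrix.mulVec_mulVec, Lbar, Matrix.mulVec_mulVec, ← W,
    Matrix.mul_nonsing_inv _ (isUnit_det_W a ha), Matrix.one_mulVec]

/-- The loading performs work against the total force `s₁ + s₂` only. -/
theorem Vbasis_Lbar_dotProduct {a : Fin 5 → ℝ} (ha : ∀ j, 0 < a j) {s : Fin 5 → ℝ}
    (hs : Balanced s) : (Vbasis a *ᵥ Lbar a) ⬝ᵥ s = s 0 + s 1 := by
  obtain ⟨h₁, h₂⟩ := hs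
  have hRD : RD = !![1, 0, 1, 0, 1; 0, 0, 1, -1, 1; 1, -1, 1, 0, 0] := by
    ext i j
    fin_cases i <;> fin_cases j <;> rfl
  have h := RD_mulVec_Vbasis_Lbar ha
  rw [hRD] at h
  generalize Vbasis a *ᵥ Lbar a = w at h ⊢
  have e₀ := congrFun h 0
  have e₁ := congrFun h 1
  have e₂ := congrFun h 2
  simp [Matrix.mulVec, dotProduct, Fin.sum_univ_five] at e₀ e₁ e₂
  simp only [dotProduct, Fin.sum_univ_five]
  -- Virtual work: `w` is a compatible elongation (`e₁`, `e₂`) of unit total length (`e₀`), paired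
  -- with a balanced stress.
  linear_combination (s 0 + s 1) * e₀ - s 3 * e₁ - s 1 * e₂ + (w 4) * (-h₁) + (w 2) * (-h₂)

/-! ### Energy coordinates -/

/-- The stress vectors with the energy norm `‖A⁻¹ s‖^A`, as a Euclidean space. -/
noncomputable def energyCoord (a : Fin 5 → ℝ) : (Fin 5 → ℝ) →L[ℝ] EuclideanSpace ℝ (Fin 5) :=
  LinearMap.toContinuousLinearMap
    { toFun := fun s => WithLp.toLp 2 fun j => s j / √(a j)
      map_add' := fun s r => by
        ext j
        simp [add_div]
      map_smul' := fun c s => by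
        ext j
        simp [mul_div_assoc] }

theorem energyCoord_apply (a s : Fin 5 → ℝ) (j : Fin 5) :
    energyCoord a s j = s j / √(a j) := rfl

theorem energyCoord_injective {a : Fin 5 → ℝ} (ha : ∀ j, 0 < a j) :
    Function.Injective (energyCoord a) := by
  intro s r h
  ext j
  have hj := congrArg (fun x : EuclideanSpace ℝ (Fin 5) => x j) h
  simp only [energyCoord_apply] at hj
  exact (div_left_inj' (Real.sqrt_pos.2 (ha j)).ne').1 hj

/-- The square roots of the stiffnesses cancel, so the energy product becomes the pairing of
elongations with stresses in which the normal cone is expressed. -/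
theorem inner_energyCoord {a : Fin 5 → ℝ} (ha : ∀ j, 0 < a j) (u s : Fin 5 → ℝ) :
    inner ℝ (energyCoord a (stiffness a *ᵥ u)) (energyCoord a s) = u ⬝ᵥ s := by
  rw [PiLp.inner_apply, dotProduct]
  refine Finset.sum_congr rfl fun j _ => ?_
  have h := Real.sqrt_pos.2 (ha j)
  have e := Real.mul_self_sqrt (ha j).le
  rw [energyCoord_apply, energyCoord_apply, stiffness_mulVec, Real.inner_apply]
  nth_rewrite 1 [← e]
  field_simp

theorem dist_energyCoord {a : Fin 5 → ℝ} (ha : ∀ j, 0 < a j) (s r : Fin 5 → ℝ) :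
    dist (energyCoord a s) (energyCoord a r) = √(∑ j, (s j - r j) ^ 2 / a j) := by
  rw [EuclideanSpace.dist_eq]
  congr 1
  refine Finset.sum_congr rfl fun j _ => ?_
  rw [energyCoord_apply, energyCoord_apply, Real.dist_eq, sq_abs, ← sub_div, div_pow,
    Real.sq_sqrt (ha j).le]

theorem weightedNorm_sub {a : Fin 5 → ℝ} (ha : ∀ j, 0 < a j) (s r : Fin 5 → ℝ) :
    weightedNorm (stiffness a) ((stiffness a)⁻¹ *ᵥ s - (stiffness a)⁻¹ *ᵥ r) =
      dist (energyCoord a s) (energyCoord a r) := by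
  have hinv : ∀ v : Fin 5 → ℝ, (stiffness a)⁻¹ *ᵥ v = fun j => v j / a j := by
    intro v
    have hdet : IsUnit (stiffness a).det := by
      rw [stiffness, Matrix.det_diagonal, isUnit_iff_ne_zero]
      exact Finset.prod_ne_zero_iff.2 fun j _ => (ha j).ne'
    rw [← stiffness_mulVec_div ha v, Matrix.mulVec_mulVec, Matrix.nonsing_inv_mul _ hdet,
      Matrix.one_mulVec, stiffness_mulVec_div ha]
  rw [dist_energyCoord ha, weightedNorm, hinv, hinv, dotProduct]
  congr 1
  refine Finset.sum_congr rfl fun j _ => ?_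
  have h := (ha j).ne'
  rw [stiffness_mulVec, Pi.sub_apply]
  field_simp


/-! ### Distance to the terminal segment -/

/-- Cancelling the common factors reduces each comparison of `ε₀` with `σ₁` to a polynomial
inequality in the stiffnesses. -/
theorem mul_div_le_of_mul_le {x P Y t d S δ : ℝ} (hx : 0 < x) (hP : 0 < P) (hY : 0 < Y)
    (hd : 0 < d) (hδ : 0 < δ) (h : t * δ ≤ S * Y) :
    x * P / Y * (t / (x * d)) ≤ S * P / (d * δ) := by
  have e : x * P / Y * (t / (x * d)) = P / d * (t / Y) := by field_simp
  have e' : S * P / (d * δ) = P / d * (S / δ) := by field_simp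
  rw [e, e']
  exact mul_le_mul_of_nonneg_left ((div_le_div_iff₀ hY hδ).2 h) (by positivity)

/-- If the energy of a displacement with the nonnegative deficits `p`, `q` in two springs is
`α p² + β q² + γ (p + q)²`, then bounds for `(p, q) = (1, 0), (0, 1)` suffice. -/
theorem min_sqrt_mul_sqrt_le {l X Y σ α β γ p q : ℝ} (hl : 0 < l) (hX : 0 ≤ X) (hY : 0 ≤ Y)
    (hα : 0 ≤ α) (hβ : 0 ≤ β) (hp : 0 ≤ p) (hq : 0 ≤ q)
    (hXσ : X * (α + γ) ≤ σ) (hYσ : Y * (β + γ) ≤ σ) (hγ : 0 ≤ γ) :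
    min (l * √X) (l * √Y) * √(α * p ^ 2 + β * q ^ 2 + γ * (p + q) ^ 2) ≤
      √σ * (l * (p + q)) := by
  have hm : min (l * √X) (l * √Y) = l * √(min X Y) := by
    rw [Monotone.map_min (fun _ _ h => Real.sqrt_le_sqrt h), mul_min_of_nonneg _ _ hl.le]
  have h₀ : 0 ≤ min X Y := le_min hX hY
  have h₁ : min X Y * (α + γ) ≤ σ :=
    (mul_le_mul_of_nonneg_right (min_le_left X Y) (by positivity)).trans hXσ
  have h₂ : min X Y * (β + γ) ≤ σ :=
    (mul_le_mul_of_nonneg_right (min_le_right X Y) (by positivity)).trans hYσ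
  have hσ : 0 ≤ σ := le_trans (by positivity) h₁
  -- With `m = min X Y`, the difference of the sides is `(σ - m(α+γ)) p² + (σ - m(β+γ)) q² + 2(σ -
  -- mγ) p q`. The sign of the mixed term is where `p, q ≥ 0` enters.
  have key : min X Y * (α * p ^ 2 + β * q ^ 2 + γ * (p + q) ^ 2) ≤ σ * (p + q) ^ 2 := by
    have hr : 0 ≤ σ - min X Y * γ := by nlinarith [mul_nonneg h₀ hα]
    nlinarith [mul_le_mul_of_nonneg_right h₁ (sq_nonneg p),
      mul_le_mul_of_nonneg_right h₂ (sq_nonneg q), mul_nonneg hr (mul_nonneg hp hq)]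
  calc min (l * √X) (l * √Y) * √(α * p ^ 2 + β * q ^ 2 + γ * (p + q) ^ 2)
      = l * √(min X Y * (α * p ^ 2 + β * q ^ 2 + γ * (p + q) ^ 2)) := by
        rw [hm, Real.sqrt_mul h₀, mul_assoc]
    _ ≤ l * √(σ * (p + q) ^ 2) := by gcongr
    _ = √σ * (l * (p + q)) := by
        rw [Real.sqrt_mul hσ, Real.sqrt_sq (by positivity)]
        ring

/-! ### Energy bounds for the three kinds of displacement -/

section Bounds

variable {b₀ b₁ b₂ b₃ b₄ l p q : ℝ}

/-- The displacement `(p, q, 0, p, q)`. -/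
theorem energy_le_of_middle (h₀ : 0 < b₀) (h₁ : 0 < b₁) (h₂ : 0 < b₂) (h₃ : 0 < b₃) (h₄ : 0 < b₄)
    (hl : 0 < l) (hp : 0 ≤ p) (hq : 0 ≤ q) :
    min
      (l * √(b₁ * (b₃ * b₄ + b₂ * (b₃ + b₄)) / (b₁ * (b₂ + b₃) + b₃ * b₄ + b₂ * (b₃ + b₄))))
      (l * √(b₀ * (b₃ * b₄ + b₂ * (b₃ + b₄)) / (b₀ * (b₂ + b₄) + b₃ * b₄ + b₂ * (b₃ + b₄)))) *
      √(p ^ 2 / b₀ + q ^ 2 / b₁ + p ^ 2 / b₃ + q ^ 2 / b₄) ≤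
    √(max 1 ((b₀ + b₃) * (b₁ + b₄) * (b₃ * b₄ + b₂ * (b₃ + b₄)) / (b₃ * b₄ *
      (b₂ * b₃ + b₁ * (b₂ + b₃) + b₂ * b₄ + b₃ * b₄ + b₀ * (b₁ + b₂ + b₄))))) *
      (l * (p + q)) := by
  have e : p ^ 2 / b₀ + q ^ 2 / b₁ + p ^ 2 / b₃ + q ^ 2 / b₄ =
      (1 / b₀ + 1 / b₃) * p ^ 2 + (1 / b₁ + 1 / b₄) * q ^ 2 + 0 * (p + q) ^ 2 := by ring
  -- The swap pairs the term of `ε₀` built from `b₀` with the deficit `p` of the spring of stiffness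
  -- `b₀`.
  rw [min_comm, e]
  refine min_sqrt_mul_sqrt_le hl (by positivity) (by positivity) (by positivity) (by positivity)
    hp hq (le_max_of_le_right ?_) (le_max_of_le_right ?_) le_rfl
  · have e : 1 / b₀ + 1 / b₃ + 0 = (b₀ + b₃) * b₄ / (b₀ * (b₃ * b₄)) := by field_simp; ring
    rw [e]
    refine mul_div_le_of_mul_le h₀ (by positivity) (by positivity) (by positivity) (by positivity)
      (sub_nonneg.1 ?_)
    -- The two sides of the polynomial inequality differ by exactly this product; the analogous
    -- facts below play the same role.
    have : 0 ≤ (b₀ + b₃) * (b₁ * b₂ * (b₃ + b₀)) := by positivity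
    linarith
  · have e : 1 / b₁ + 1 / b₄ + 0 = (b₁ + b₄) * b₃ / (b₁ * (b₃ * b₄)) := by field_simp; ring
    rw [e]
    refine mul_div_le_of_mul_le h₁ (by positivity) (by positivity) (by positivity) (by positivity)
      (sub_nonneg.1 ?_)
    have : 0 ≤ (b₁ + b₄) * (b₀ * b₂ * (b₄ + b₁)) := by positivity
    linarith

/-- The displacement `(p, q, p, 0, p + q)`. -/
theorem energy_le_of_left (h₀ : 0 < b₀) (h₁ : 0 < b₁) (h₂ : 0 < b₂) (h₃ : 0 < b₃) (h₄ : 0 < b₄)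
    (hl : 0 < l) (hp : 0 ≤ p) (hq : 0 ≤ q) :
    min
      (l * √(b₁ * (b₃ * b₄ + b₂ * (b₃ + b₄)) / (b₁ * (b₂ + b₃) + b₃ * b₄ + b₂ * (b₃ + b₄))))
      (l * √(b₀ * (b₃ * b₄ + b₂ * (b₃ + b₄)) / (b₀ * (b₂ + b₄) + b₃ * b₄ + b₂ * (b₃ + b₄)))) *
      √(p ^ 2 / b₀ + q ^ 2 / b₁ + p ^ 2 / b₂ + (p + q) ^ 2 / b₄) ≤
    √(max 1 ((b₂ * (b₁ + b₄) + b₀ * (b₁ + b₂ + b₄)) * (b₃ * b₄ + b₂ * (b₃ + b₄)) / (b₂ * b₄ *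
      (b₂ * b₃ + b₁ * (b₂ + b₃) + b₂ * b₄ + b₃ * b₄ + b₀ * (b₁ + b₂ + b₄))))) *
      (l * (p + q)) := by
  have e : p ^ 2 / b₀ + q ^ 2 / b₁ + p ^ 2 / b₂ + (p + q) ^ 2 / b₄ =
      (1 / b₀ + 1 / b₂) * p ^ 2 + 1 / b₁ * q ^ 2 + 1 / b₄ * (p + q) ^ 2 := by ring
  rw [min_comm, e]
  refine min_sqrt_mul_sqrt_le hl (by positivity) (by positivity) (by positivity) (by positivity)
    hp hq (le_max_of_le_right ?_) (le_max_of_le_right ?_) (by positivity)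
  · have e : 1 / b₀ + 1 / b₂ + 1 / b₄ =
        (b₂ * b₄ + b₀ * b₄ + b₀ * b₂) / (b₀ * (b₂ * b₄)) := by field_simp
    rw [e]
    refine mul_div_le_of_mul_le h₀ (by positivity) (by positivity) (by positivity) (by positivity)
      (sub_nonneg.1 ?_)
    have : 0 ≤ b₁ * b₃ * b₂ ^ 2 := by positivity
    linarith
  · have e : 1 / b₁ + 1 / b₄ = b₂ * (b₁ + b₄) / (b₁ * (b₂ * b₄)) := by field_simp; ring
    rw [e]
    refine mul_div_le_of_mul_le h₁ (by positivity) (by positivity) (by positivity) (by positivity)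
      (sub_nonneg.1 ?_)
    have : 0 ≤ b₀ * b₃ * (b₁ + b₂ + b₄) ^ 2 := by positivity
    linarith

/-- The displacement `(p, q, -q, p + q, 0)`. -/
theorem energy_le_of_right (h₀ : 0 < b₀) (h₁ : 0 < b₁) (h₂ : 0 < b₂) (h₃ : 0 < b₃) (h₄ : 0 < b₄)
    (hl : 0 < l) (hp : 0 ≤ p) (hq : 0 ≤ q) :
    min
      (l * √(b₁ * (b₃ * b₄ + b₂ * (b₃ + b₄)) / (b₁ * (b₂ + b₃) + b₃ * b₄ + b₂ * (b₃ + b₄))))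
      (l * √(b₀ * (b₃ * b₄ + b₂ * (b₃ + b₄)) / (b₀ * (b₂ + b₄) + b₃ * b₄ + b₂ * (b₃ + b₄)))) *
      √(p ^ 2 / b₀ + q ^ 2 / b₁ + q ^ 2 / b₂ + (p + q) ^ 2 / b₃) ≤
    √(max 1 ((b₀ * (b₁ + b₂) + b₂ * b₃ + b₁ * (b₂ + b₃)) * (b₃ * b₄ + b₂ * (b₃ + b₄)) / (b₂ * b₃ *
      (b₂ * b₃ + b₁ * (b₂ + b₃) + b₂ * b₄ + b₃ * b₄ + b₀ * (b₁ + b₂ + b₄))))) *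
      (l * (p + q)) := by
  -- Mirror symmetry of the network: springs `0`, `1` and springs `3`, `4` are exchanged, and spring
  -- `2` changes the sign of its stress.
  have h := energy_le_of_left h₁ h₀ h₂ h₄ h₃ hl hq hp
  rw [min_comm] at h
  convert h using 2
  · congr 3 <;> ring_nf
  · congr 1; ring
  · congr 2; ring
  · ring

end Bounds


/-! ### Terminal stresses -/

namespace Scenario

theorem balanced_terminalStress (sc : Scenario) (cp : Fin 5 → ℝ) (x : ℝ) :
    Balanced (sc.terminalStress cp x) := by
  cases sc <;> constructor <;> simp [terminalStress] <;> ring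

theorem terminalStress_of_mem_I₀ (sc : Scenario) (cp : Fin 5 → ℝ) (x : ℝ) {j : Fin 5}
    (hj : j ∈ sc.I₀) : sc.terminalStress cp x j = cp j := by
  cases sc <;> simp only [I₀, Finset.mem_insert, Finset.mem_singleton] at hj <;>
    rcases hj with rfl | rfl <;> simp [terminalStress]

theorem terminalStress_free (sc : Scenario) (cp : Fin 5 → ℝ) (x : ℝ) :
    sc.terminalStress cp x sc.free = x := by
  cases sc <;> simp [terminalStress, free]

theorem terminalStress_force (sc : Scenario) (cp : Fin 5 → ℝ) (x y : ℝ) :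
    sc.terminalStress cp x 0 + sc.terminalStress cp x 1 =
      sc.terminalStress cp y 0 + sc.terminalStress cp y 1 := by
  cases sc <;> simp [terminalStress] <;> ring

theorem terminalStress_combo (sc : Scenario) (cp : Fin 5 → ℝ) (x y : ℝ) {u v : ℝ}
    (h : u + v = 1) : sc.terminalStress cp (u * x + v * y) =
      u • sc.terminalStress cp x + v • sc.terminalStress cp y := by
  obtain rfl : v = 1 - u := by linarith
  ext j
  cases sc <;> fin_cases j <;> simp [terminalStress] <;> ring

theorem segment_vertex (sc : Scenario) {cm cp : Fin 5 → ℝ} (hc : ∀ j, cm j ≤ cp j) :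
    segment ℝ (sc.vertex₁ cm cp) (sc.vertex₂ cp) =
      sc.terminalStress cp '' Icc (cm sc.free) (cp sc.free) := by
  rw [← segment_eq_Icc (hc sc.free)]
  ext s
  constructor
  · rintro ⟨u, v, hu, hv, huv, rfl⟩
    exact ⟨_, ⟨u, v, hu, hv, huv, rfl⟩, sc.terminalStress_combo cp _ _ huv⟩
  · rintro ⟨x, ⟨u, v, hu, hv, huv, rfl⟩, rfl⟩
    exact ⟨u, v, hu, hv, huv, (sc.terminalStress_combo cp _ _ huv).symm⟩

/-- By convexity only the endpoints matter. There the springs of `I₀` and the free spring are at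
limits of their own, and feasibility concerns exactly the two others. -/
theorem Feasible.segment_subset {sc : Scenario} {cm cp : Fin 5 → ℝ} (hfeas : sc.Feasible cm cp)
    (hc : ∀ j, cm j ≤ cp j) :
    segment ℝ (sc.vertex₁ cm cp) (sc.vertex₂ cp) ⊆ stressSet cm cp := by
  have hmem : ∀ x ∈ Icc (cm sc.free) (cp sc.free),
      (∀ j, j ∉ sc.I₀ → j ≠ sc.free →
        cm j ≤ sc.terminalStress cp x j ∧ sc.terminalStress cp x j ≤ cp j) →
      sc.terminalStress cp x ∈ stressSet cm cp := by
    refine fun x hx h => ⟨sc.balanced_terminalStress cp x, fun j => ?_⟩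
    by_cases hj : j ∈ sc.I₀
    · rw [sc.terminalStress_of_mem_I₀ cp x hj]
      exact ⟨hc j, le_rfl⟩
    · by_cases hjk : j = sc.free
      · rw [hjk, sc.terminalStress_free]
        exact hx
      · exact h j hj hjk
  refine (convex_stressSet cm cp).segment_subset
    (hmem _ (left_mem_Icc.2 (hc _)) fun j hj hjk => (hfeas j hj hjk).1)
    (hmem _ (right_mem_Icc.2 (hc _)) fun j hj hjk => (hfeas j hj hjk).2)

theorem ε₀_pos (sc : Scenario) {a : Fin 5 → ℝ} (ha : ∀ j, 0 < a j) {l : ℝ} (hl : 0 < l) :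
    0 < sc.ε₀ a l := by
  have h0 := ha 0
  have h1 := ha 1
  have h2 := ha 2
  have h3 := ha 3
  have h4 := ha 4
  cases sc <;> refine lt_min ?_ ?_ <;> simp only [hUpper, hLower] <;> positivity

theorem one_le_σ₁ (sc : Scenario) (a : Fin 5 → ℝ) : 1 ≤ sc.σ₁ a := by
  cases sc <;> exact le_max_left _ _

/-- The deficit of the force controls the distance to the point of the terminal segment with the
same stress of the free spring. -/
theorem ε₀_mul_dist_le (sc : Scenario) {a cm cp : Fin 5 → ℝ} (ha : ∀ j, 0 < a j) {l : ℝ}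
    (hl : 0 < l) {s : Fin 5 → ℝ} (hs : s ∈ stressSet cm cp) (x : ℝ) :
    sc.ε₀ a l * dist (energyCoord a s) (energyCoord a (sc.terminalStress cp (s sc.free))) ≤
      √(sc.σ₁ a) * (l * (sc.terminalStress cp x 0 + sc.terminalStress cp x 1 - (s 0 + s 1))) := by
  obtain ⟨⟨e₁, e₂⟩, hb⟩ := hs
  have hp : ∀ j, 0 ≤ cp j - s j := fun j => sub_nonneg.2 (hb j).2
  have h0 := ha 0
  have h1 := ha 1
  have h2 := ha 2
  have h3 := ha 3
  have h4 := ha 4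
  have e₃ : s 4 = s 1 + s 2 := by linarith
  rw [sc.terminalStress_force cp x (s sc.free), dist_energyCoord ha, Fin.sum_univ_five]
  cases sc
  · refine (Eq.trans_le (congrArg₂ (· * ·) rfl (congrArg Real.sqrt ?_))
      (energy_le_of_middle h0 h1 h2 h3 h4 hl (hp 0) (hp 1))).trans_eq
      (congrArg₂ (· * ·) rfl (congrArg (l * ·) ?_))
    · simp [terminalStress, free, e₃, e₂]
      ring
    · simp [terminalStress, free]
      linarith
  · refine (Eq.trans_le (congrArg₂ (· * ·) rfl (congrArg Real.sqrt ?_))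
      (energy_le_of_left h0 h1 h2 h3 h4 hl (hp 0) (hp 1))).trans_eq
      (congrArg₂ (· * ·) rfl (congrArg (l * ·) ?_))
    · simp [terminalStress, free, e₃, e₂]
      ring
    · simp [terminalStress, free]
      linarith
  · refine (Eq.trans_le (congrArg₂ (· * ·) rfl (congrArg Real.sqrt ?_))
      (energy_le_of_right h0 h1 h2 h3 h4 hl (hp 0) (hp 1))).trans_eq
      (congrArg₂ (· * ·) rfl (congrArg (l * ·) ?_))
    · simp [terminalStress, free, e₃, e₂]
      ring
    · simp [terminalStress, free]
      linarith
  -- The last three scenarios follow from the same bounds by exchanging springs `0`, `1` with `3`,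
  -- `4`. This symmetry preserves `Δ`, and balance rewrites the force as `s 3 + s 4`.
  · refine (Eq.trans_le (congrArg₂ (· * ·) rfl (congrArg Real.sqrt ?_))
      (energy_le_of_left h3 h4 h2 h0 h1 hl (hp 3) (hp 4))).trans_eq
      (congrArg₂ (· * ·) (congrArg (fun r => √(max 1 r)) ?_) (congrArg (l * ·) ?_))
    · simp [terminalStress, free, e₃, e₂]
      ring
    · unfold Δ
      congr 1 <;> ring
    · simp [terminalStress, free]
      linarith
  · refine (Eq.trans_le (congrArg₂ (· * ·) rfl (congrArg Real.sqrt ?_))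
      (energy_le_of_right h3 h4 h2 h0 h1 hl (hp 3) (hp 4))).trans_eq
      (congrArg₂ (· * ·) (congrArg (fun r => √(max 1 r)) ?_) (congrArg (l * ·) ?_))
    · simp [terminalStress, free, e₃, e₂]
      ring
    · unfold Δ
      congr 1 <;> ring
    · simp [terminalStress, free]
      linarith
  · refine (Eq.trans_le (congrArg₂ (· * ·) rfl (congrArg Real.sqrt ?_))
      (energy_le_of_middle h3 h4 h2 h0 h1 hl (hp 3) (hp 4))).trans_eq
      (congrArg₂ (· * ·) (congrArg (fun r => √(max 1 r)) ?_) (congrArg (l * ·) ?_))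
    · simp [terminalStress, free, e₃, e₂]
      ring
    · unfold Δ
      congr 1 <;> ring
    · simp [terminalStress, free]
      linarith

end Scenario

/-! ### Evolution of the stresses -/

theorem stress_mem_stressSet {a cm cp : Fin 5 → ℝ} {l₀ l₁ t : ℝ} {y : ℝ → Fin 5 → ℝ}
    (ha : ∀ j, 0 < a j)
    (hy : y t ∈ movingSet (elasticSet (stiffness a) (phaseSpace a) cm cp) (shift a l₀ l₁) t) :
    stress a l₀ l₁ y t ∈ stressSet cm cp := by
  obtain ⟨u, hu, hut⟩ := hy
  rw [stress, ← hut, add_sub_cancel_right]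
  exact (mem_elasticSet_iff ha u).1 hu

theorem hasDerivAt_shift (a : Fin 5 → ℝ) (l₀ l₁ t : ℝ) :
    HasDerivAt (shift a l₀ l₁) (-(l₁ • (Vbasis a *ᵥ Lbar a))) t := by
  have h : HasDerivAt (loading l₀ l₁) (l₁ * 1) t :=
    ((hasDerivAt_id t).const_mul l₁).const_add l₀
  rw [mul_one] at h
  exact (h.smul_const (Vbasis a *ᵥ Lbar a)).neg

theorem absolutelyContinuousOnInterval_shift (a : Fin 5 → ℝ) (l₀ l₁ b c : ℝ) :
    AbsolutelyContinuousOnInterval (shift a l₀ l₁) b c := by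
  refine ContDiffOn.absolutelyContinuousOnInterval (ContDiff.contDiffOn ?_)
  unfold shift loading
  fun_prop

/-- The stress vector in energy coordinates as a continuous linear function of `y - c`. -/
noncomputable def elasticCoord (a : Fin 5 → ℝ) : (Fin 5 → ℝ) →L[ℝ] EuclideanSpace ℝ (Fin 5) :=
  energyCoord a ∘L LinearMap.toContinuousLinearMap (stiffness a).mulVecLin

theorem elasticCoord_apply (a u : Fin 5 → ℝ) :
    elasticCoord a u = energyCoord a (stiffness a *ᵥ u) := rfl

/-- The velocity of the stresses makes an acute angle with the direction to every admissible
stress vector of greater force. -/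
theorem exists_hasDerivAt_energyCoord_stress {a cm cp : Fin 5 → ℝ} {l₀ l₁ t : ℝ}
    {y : ℝ → Fin 5 → ℝ} {y' : Fin 5 → ℝ} (ha : ∀ j, 0 < a j) (hy' : HasDerivAt y y' t)
    (hN : -y' ∈ normalCone (stiffness a) (phaseSpace a)
      (movingSet (elasticSet (stiffness a) (phaseSpace a) cm cp) (shift a l₀ l₁) t) (y t)) :
    ∃ z', HasDerivAt (fun t => energyCoord a (stress a l₀ l₁ y t)) z' t ∧
      ∀ p ∈ stressSet cm cp,
        l₁ * (p 0 + p 1 - (stress a l₀ l₁ y t 0 + stress a l₀ l₁ y t 1)) ≤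
          inner ℝ z' (energyCoord a p - energyCoord a (stress a l₀ l₁ y t)) := by
  obtain ⟨-, hmem, hN⟩ := hN
  have hs := stress_mem_stressSet ha hmem
  refine ⟨_, (elasticCoord a).hasFDerivAt.comp_hasDerivAt t
    (hy'.sub (hasDerivAt_shift a l₀ l₁ t)), fun p hp => ?_⟩
  -- Test the normal cone with the point of the moving set whose stress is `p`. In `z'` the term
  -- `y'` then contributes nonnegatively, and `-c'` contributes `l₁` times the gain of force.
  have hξ := hN ((fun j => p j / a j) + shift a l₀ l₁ t)
    ⟨_, (mem_elasticSet_iff ha _).2 (by rwa [stiffness_mulVec_div ha]), rfl⟩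
  have e : stiffness a *ᵥ ((fun j => p j / a j) + shift a l₀ l₁ t - y t) =
      p - stress a l₀ l₁ y t := by
    rw [show (fun j => p j / a j) + shift a l₀ l₁ t - y t =
      (fun j => p j / a j) - (y t - shift a l₀ l₁ t) by abel, Matrix.mulVec_sub,
      stiffness_mulVec_div ha, stress]
  rw [e, neg_dotProduct] at hξ
  rw [← map_sub, elasticCoord_apply, inner_energyCoord ha, sub_neg_eq_add, add_dotProduct,
    smul_dotProduct, dotProduct_sub (Vbasis a *ᵥ Lbar a), Vbasis_Lbar_dotProduct ha hp.1,
    Vbasis_Lbar_dotProduct ha hs.1, smul_eq_mul]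
  linarith

/-- The point is carried along rigidly by the moving set. Its velocity is `c'`, and `-c'` represents
`l₁` times the force functional, hence is normal to the set at a maximizer of the force. -/
theorem isSolution_of_forall_le {a cm cp : Fin 5 → ℝ} {l₀ l₁ : ℝ} (ha : ∀ j, 0 < a j)
    (hl₁ : 0 < l₁) {s : Fin 5 → ℝ} (hs : s ∈ stressSet cm cp)
    (hmax : ∀ r ∈ stressSet cm cp, r 0 + r 1 ≤ s 0 + s 1) :
    IsSolution a cm cp l₀ l₁ (fun t => (fun j => s j / a j) + shift a l₀ l₁ t) := by
  have hmem : (fun j => s j / a j) ∈ elasticSet (stiffness a) (phaseSpace a) cm cp := by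
    rwa [mem_elasticSet_iff ha, stiffness_mulVec_div ha]
  refine ⟨fun T _ => ?_, ⟨_, hmem, rfl⟩, Filter.Eventually.of_forall fun t => ?_⟩
  · exact (LipschitzWith.const (fun j => s j / a j)).lipschitzOnWith.absolutelyContinuousOnInterval.add
      (absolutelyContinuousOnInterval_shift a l₀ l₁ 0 T)
  · refine ⟨_, (hasDerivAt_shift a l₀ l₁ t).const_add _, ?_, ⟨_, hmem, rfl⟩, ?_⟩
    · rw [neg_neg]
      exact (phaseSpace a).smul_mem _ ⟨_, rfl⟩
    · rintro _ ⟨u, hu, rfl⟩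
      have hr := (mem_elasticSet_iff ha u).1 hu
      rw [neg_neg, add_sub_add_right_eq_sub, Matrix.mulVec_sub, stiffness_mulVec_div ha,
        smul_dotProduct, dotProduct_sub, Vbasis_Lbar_dotProduct ha hr.1,
        Vbasis_Lbar_dotProduct ha hs.1, smul_eq_mul]
      exact mul_nonpos_of_nonneg_of_nonpos hl₁.le (sub_nonpos.2 (hmax _ hr))

/-- After the time `τ_d`, the stress vector is a constant point of the terminal segment. -/
theorem exists_terminal_stress {a cm cp : Fin 5 → ℝ} {l₀ l₁ : ℝ} (ha : ∀ j, 0 < a j)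
    (hc : ∀ j, cm j ≤ cp j) (hl₁ : 0 < l₁) {sc : Scenario} (hfeas : sc.Feasible cm cp)
    {y : ℝ → Fin 5 → ℝ} (hy : IsSolution a cm cp l₀ l₁ y) :
    ∃ s ∈ segment ℝ (sc.vertex₁ cm cp) (sc.vertex₂ cp),
      ∀ t : ℝ, sc.τd a cm cp l₁ ≤ t → stress a l₀ l₁ y t = s := by
  have hsub := hfeas.segment_subset hc
  have hσ : 0 < √(sc.σ₁ a) := Real.sqrt_pos.2 (one_pos.trans_le (sc.one_le_σ₁ a))
  have hε := sc.ε₀_pos ha hl₁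
  have hK : IsCompact (energyCoord a '' segment ℝ (sc.vertex₁ cm cp) (sc.vertex₂ cp)) := by
    rw [segment_eq_image]
    exact ((isCompact_Icc.image (by fun_prop))).image (energyCoord a).continuous
  have hne : (segment ℝ (sc.vertex₁ cm cp) (sc.vertex₂ cp)).Nonempty :=
    ⟨_, left_mem_segment ℝ _ _⟩
  have hmem : ∀ s ∈ stressSet cm cp, energyCoord a (sc.terminalStress cp (s sc.free)) ∈
      energyCoord a '' segment ℝ (sc.vertex₁ cm cp) (sc.vertex₂ cp) := by
    rw [sc.segment_vertex hc]
    exact fun s hs => mem_image_of_mem _ (mem_image_of_mem _ (hs.2 _))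
  suffices h : ∃ z ∈ energyCoord a '' segment ℝ (sc.vertex₁ cm cp) (sc.vertex₂ cp),
      ∀ t, sc.τd a cm cp l₁ ≤ t → energyCoord a (stress a l₀ l₁ y t) = z by
    obtain ⟨_, ⟨s, hs, rfl⟩, hconst⟩ := h
    exact ⟨s, hs, fun t ht => energyCoord_injective ha (hconst t ht)⟩
  -- With this rate, `κ * τ_d` is exactly the energy distance between `cp` and `cm`.
  refine finite_time_absorption (κ := sc.ε₀ a l₁ / √(sc.σ₁ a)) hK (hne.image _) ?_
    (by positivity) ?_ ?_
  · intro T hT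
    exact ((hy.absCont T hT).sub
      (absolutelyContinuousOnInterval_shift a l₀ l₁ 0 T)).lipschitz_comp
        (elasticCoord a).lipschitz
  · filter_upwards [hy.inclusion] with t ⟨y', hy', hN⟩
    have hst := stress_mem_stressSet ha hN.2.1
    obtain ⟨z', hz', hin⟩ := exists_hasDerivAt_energyCoord_stress ha hy' hN
    refine ⟨z', hz', ?_⟩
    rintro _ ⟨p, hp, rfl⟩
    refine le_trans ?_ (hin p (hsub hp))
    rw [sc.segment_vertex hc] at hp
    obtain ⟨x, -, rfl⟩ := hp
    rw [div_mul_eq_mul_div, div_le_iff₀' hσ]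
    exact (mul_le_mul_of_nonneg_left (Metric.infDist_le_dist_of_mem (hmem _ hst)) hε.le).trans
      (sc.ε₀_mul_dist_le ha hl₁ hst x)
  · have hs₀ := stress_mem_stressSet ha hy.init
    have e : sc.ε₀ a l₁ / √(sc.σ₁ a) * sc.τd a cm cp l₁ =
        dist (energyCoord a cp) (energyCoord a cm) := by
      rw [Scenario.τd, weightedNorm_sub ha, Scenario.σ₂, max_self]
      field_simp
    rw [e]
    refine (Metric.infDist_le_dist_of_mem (hmem _ hs₀)).trans ?_
    have ht : sc.terminalStress cp (stress a l₀ l₁ y 0 sc.free) ∈ stressSet cm cp := by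
      refine hsub ?_
      rw [sc.segment_vertex hc]
      exact mem_image_of_mem _ (hs₀.2 _)
    -- Both the initial stress and its comparison point on the segment satisfy the limits, so each
    -- coordinate differs by at most `cp j - cm j`.
    rw [dist_energyCoord ha, dist_energyCoord ha]
    refine Real.sqrt_le_sqrt (Finset.sum_le_sum fun j _ => ?_)
    have hj := ha j
    have h₁ := hs₀.2 j
    have h₂ := ht.2 j
    gcongr ?_ / _
    exact sq_le_sq' (by linarith) (by linarith)

end FiveSprings

/-! ### The proposition -/

theorem proposition10 (a cm cp : Fin 5 → ℝ) (l₀ l₁ : ℝ)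
    (ha : ∀ j, 0 < a j) (hc : ∀ j, cm j ≤ cp j) (hl₀ : 0 < l₀) (hl₁ : 0 < l₁)
    (sc : FiveSprings.Scenario) (hfeas : sc.Feasible cm cp) :
    (∀ y : ℝ → Fin 5 → ℝ, FiveSprings.IsSolution a cm cp l₀ l₁ y →
      (∀ t : ℝ, sc.τd a cm cp l₁ ≤ t → ∀ j ∈ sc.I₀,
        IsPlastic cm cp (FiveSprings.stress a l₀ l₁ y t) j ∧
          FiveSprings.stress a l₀ l₁ y t j = cp j) ∧
      ∃ s ∈ segment ℝ (sc.vertex₁ cm cp) (sc.vertex₂ cp),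
        ∀ t : ℝ, sc.τd a cm cp l₁ ≤ t → FiveSprings.stress a l₀ l₁ y t = s) ∧
    (∀ s ∈ segment ℝ (sc.vertex₁ cm cp) (sc.vertex₂ cp),
      ∃ y : ℝ → Fin 5 → ℝ, FiveSprings.IsSolution a cm cp l₀ l₁ y ∧
        ∀ t : ℝ, sc.τd a cm cp l₁ ≤ t → FiveSprings.stress a l₀ l₁ y t = s) := by
  refine ⟨fun y hy => ?_, fun s hs => ?_⟩
  · obtain ⟨s, hs, hconst⟩ := FiveSprings.exists_terminal_stress ha hc hl₁ hfeas hy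
    refine ⟨fun t ht j hj => ?_, s, hs, hconst⟩
    rw [sc.segment_vertex hc] at hs
    obtain ⟨x, -, rfl⟩ := hs
    have e : FiveSprings.stress a l₀ l₁ y t j = cp j :=
      (congrFun (hconst t ht) j).trans (sc.terminalStress_of_mem_I₀ cp x hj)
    exact ⟨fun h => h.2.ne e, e⟩
  · have hsK := hfeas.segment_subset hc hs
    refine ⟨_, FiveSprings.isSolution_of_forall_le ha hl₁ hsK fun r hr => ?_, fun t _ => ?_⟩
    · rw [sc.segment_vertex hc] at hs
      obtain ⟨x, -, rfl⟩ := hs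
      have hσ : 0 < √(sc.σ₁ a) := Real.sqrt_pos.2 (one_pos.trans_le (sc.one_le_σ₁ a))
      -- The distance estimate also shows that the segment maximizes the force: a deficit bounding a
      -- nonnegative quantity is itself nonnegative.
      have h := (mul_nonneg (sc.ε₀_pos ha hl₁).le dist_nonneg).trans
        (sc.ε₀_mul_dist_le ha hl₁ hr x)
      exact sub_nonneg.1 (nonneg_of_mul_nonneg_right (nonneg_of_mul_nonneg_right h hσ) hl₁)
    · rw [FiveSprings.stress, add_sub_cancel_right, FiveSprings.stiffness_mulVec_div ha]
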